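/- Let $R$ be an associative ring with identity such that every simple right $R$-module is finitely presented. For each simple right $R$-module $S$ fix an exact sequence $P_1 \xrightarrow{f} P_0 \to S \to 0$ with $P_0, P_1$ finitely generated projective right $R$-modules, and let $\operatorname{Tr}(S)$ be the resulting Auslander–Bridger transpose, i.e. the left $R$-module $\operatorname{Coker}\bigl(f^*\colon \operatorname{Hom}_R(P_0,R)\to \operatorname{Hom}_R(P_1,R)\bigr)$. A left $R$-module $M$ is called absolutely pure if $\operatorname{Ext}^1_R(A,M)=0$ for every finitely presented left $R$-module $A$. A right $R$-module $M$ is called neat-flat if for every epimorphism $N\to M$ of right $R$-modules and every simple right $R$-module $S$ the induced map $\operatorname{Hom}_R(S,N)\to\operatorname{Hom}_R(S,M)$ is surjective. Then, for any such choice of presentations, the following statements are equivalent: 1. For every left $R$-module $M$: $M$ is absolutely pure if and only if $\operatorname{Ext}^1_R(\operatorname{Tr}(S),M)=0$ for each simple right $R$-module $S$. 2. For every right $R$-module $M$: $M$ is flat if and only if $M$ is neat-flat. -/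

import Mathlib

/-! Conventions. `R` is an associative ring with identity, not assumed commutative. A left
`R`-module is `[Module R M]`; a right `R`-module is `[Module Rᵐᵒᵖ M]`, the right action `m · r`
being `MulOpposite.op r • m`. -/

open scoped TensorProduct

universe u

noncomputable section

/-! ### Tensor products over a noncommutative ring, and flat right modules -/

/-- The subgroup of `M ⊗[ℤ] N` generated by all `(m · r) ⊗ n - m ⊗ (r • n)`, for a right
`R`-module `M` and a left `R`-module `N`. -/
def balancingSubgroup (R : Type u) [Ring R] (M : Type u) [AddCommGroup M] [Module Rᵐᵒᵖ M]
    (N : Type u) [AddCommGroup N] [Module R N] : AddSubgroup (M ⊗[ℤ] N) :=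
  AddSubgroup.closure
    {t | ∃ (m : M) (r : R) (n : N), t = (MulOpposite.op r • m) ⊗ₜ[ℤ] n - m ⊗ₜ[ℤ] (r • n)}

/-- The abelian group `M ⊗_R N`, for a right `R`-module `M` and a left `R`-module `N`. -/
abbrev BalancedTensor (R : Type u) [Ring R] (M : Type u) [AddCommGroup M] [Module Rᵐᵒᵖ M]
    (N : Type u) [AddCommGroup N] [Module R N] : Type u :=
  (M ⊗[ℤ] N) ⧸ balancingSubgroup R M N

theorem balancingSubgroup_le_comap (R : Type u) [Ring R]
    (M : Type u) [AddCommGroup M] [Module Rᵐᵒᵖ M]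
    {N N' : Type u} [AddCommGroup N] [Module R N] [AddCommGroup N'] [Module R N']
    (f : N →ₗ[R] N') :
    balancingSubgroup R M N ≤
      (balancingSubgroup R M N').comap
        ((f.toAddMonoidHom.toIntLinearMap).lTensor M).toAddMonoidHom := by
  refine (AddSubgroup.closure_le _).2 ?_
  rintro _ ⟨m, r, n, rfl⟩
  refine AddSubgroup.subset_closure ⟨m, r, f n, ?_⟩
  simp

/-- The homomorphism `M ⊗_R f : M ⊗_R N → M ⊗_R N'` induced by a map `f : N → N'` of left
`R`-modules. -/
def balancedTensorMap (R : Type u) [Ring R] (M : Type u) [AddCommGroup M] [Module Rᵐᵒᵖ M]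
    {N N' : Type u} [AddCommGroup N] [Module R N] [AddCommGroup N'] [Module R N']
    (f : N →ₗ[R] N') : BalancedTensor R M N →+ BalancedTensor R M N' :=
  QuotientAddGroup.map _ _ ((f.toAddMonoidHom.toIntLinearMap).lTensor M).toAddMonoidHom
    (balancingSubgroup_le_comap R M f)

/-- A right `R`-module `M` is flat if `M ⊗_R -` preserves injective maps of left `R`-modules. -/
def IsFlatRight (R : Type u) [Ring R] (M : Type u) [AddCommGroup M] [Module Rᵐᵒᵖ M] : Prop :=
  ∀ (N N' : Type u) [AddCommGroup N] [Module R N] [AddCommGroup N'] [Module R N']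
    (f : N →ₗ[R] N'), Function.Injective f → Function.Injective (balancedTensorMap R M f)

/-! ### Neat-flat right modules -/

/-- A right `R`-module `M` is neat-flat if for every epimorphism `f : N → M` of right `R`-modules
and every simple right `R`-module `S`, the map `Hom(S, f) : Hom(S, N) → Hom(S, M)` is
surjective. -/
def IsNeatFlatRight (R : Type u) [Ring R] (M : Type u) [AddCommGroup M] [Module Rᵐᵒᵖ M] : Prop :=
  ∀ (N : Type u) [AddCommGroup N] [Module Rᵐᵒᵖ N] (f : N →ₗ[Rᵐᵒᵖ] M), Function.Surjective f →
    ∀ (S : Type u) [AddCommGroup S] [Module Rᵐᵒᵖ S] [IsSimpleModule Rᵐᵒᵖ S],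
      Function.Surjective (fun g : S →ₗ[Rᵐᵒᵖ] N => f ∘ₗ g)

/-! ### Absolutely pure left modules -/

/-- Vanishing of `Ext¹_R(A, M)` for left `R`-modules `A` and `M`. -/
def ExtOneVanishes (R : Type u) [Ring R] (A : Type u) [AddCommGroup A] [Module R A]
    (M : Type u) [AddCommGroup M] [Module R M] : Prop :=
  Subsingleton (CategoryTheory.Abelian.Ext (ModuleCat.of R A) (ModuleCat.of R M) 1)

/-- A left `R`-module `M` is absolutely pure (FP-injective) if `Ext¹_R(A, M) = 0` for every
finitely presented left `R`-module `A`. -/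
def IsAbsolutelyPure (R : Type u) [Ring R] (M : Type u) [AddCommGroup M] [Module R M] : Prop :=
  ∀ (A : Type u) [AddCommGroup A] [Module R A] [Module.FinitePresentation R A],
    ExtOneVanishes R A M

/-! ### The Auslander–Bridger transpose -/

/-- A presentation `P₁ → P₀ → S → 0` of a right `R`-module `S` by finitely generated projective
right `R`-modules `P₁`, `P₀`. -/
structure ProjPresentation (R : Type u) [Ring R] (S : Type u) [AddCommGroup S]
    [Module Rᵐᵒᵖ S] where
  P₁ : Type u
  P₀ : Type u
  [addCommGroup₁ : AddCommGroup P₁]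
  [addCommGroup₀ : AddCommGroup P₀]
  [module₁ : Module Rᵐᵒᵖ P₁]
  [module₀ : Module Rᵐᵒᵖ P₀]
  finite₁ : Module.Finite Rᵐᵒᵖ P₁
  finite₀ : Module.Finite Rᵐᵒᵖ P₀
  projective₁ : Module.Projective Rᵐᵒᵖ P₁
  projective₀ : Module.Projective Rᵐᵒᵖ P₀
  f : P₁ →ₗ[Rᵐᵒᵖ] P₀
  g : P₀ →ₗ[Rᵐᵒᵖ] S
  exact : Function.Exact f g
  surjective : Function.Surjective g

attribute [instance] ProjPresentation.addCommGroup₁ ProjPresentation.addCommGroup₀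
  ProjPresentation.module₁ ProjPresentation.module₀

/-- A finitely presented right module has such a presentation. -/
theorem nonempty_projPresentation (R : Type u) [Ring R] (S : Type u) [AddCommGroup S]
    [Module Rᵐᵒᵖ S] [Module.FinitePresentation Rᵐᵒᵖ S] : Nonempty (ProjPresentation R S) := by
  obtain ⟨n, m, f, g, hf, hg⟩ := Module.FinitePresentation.exists_fin' Rᵐᵒᵖ S
  exact ⟨{ P₁ := Fin m → Rᵐᵒᵖ, P₀ := Fin n → Rᵐᵒᵖ,
           finite₁ := inferInstance, finite₀ := inferInstance,
           projective₁ := inferInstance, projective₀ := inferInstance,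
           f := g, g := f, exact := hg, surjective := hf }⟩

/-- The map `f^* : Hom_R(P₀, R) → Hom_R(P₁, R)`, `h ↦ h ∘ f`, of left `R`-modules. The left
action on these groups is `(r • h) p = r * h p`. -/
def ProjPresentation.dualMap {R : Type u} [Ring R] {S : Type u} [AddCommGroup S] [Module Rᵐᵒᵖ S]
    (γ : ProjPresentation R S) : (γ.P₀ →ₗ[Rᵐᵒᵖ] R) →ₗ[R] (γ.P₁ →ₗ[Rᵐᵒᵖ] R) :=
  LinearMap.lcomp R R γ.f

/-- The Auslander–Bridger transpose of `S` with respect to the presentation `γ`: the left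
`R`-module `Tr_γ(S) = Coker(f^* : Hom_R(P₀, R) → Hom_R(P₁, R))`. -/
abbrev ProjPresentation.Tr {R : Type u} [Ring R] {S : Type u} [AddCommGroup S] [Module Rᵐᵒᵖ S]
    (γ : ProjPresentation R S) : Type u :=
  (γ.P₁ →ₗ[Rᵐᵒᵖ] R) ⧸ LinearMap.range γ.dualMap

end

/-!
The Ext condition is made concrete first: `Ext¹(Tr A, M) = 0` says that every map `P₀^* → M` killing
the kernel of `f^* : P₀^* → P₁^*` factors through `f^*` (`extOneVanishes_Tr_iff`). Write `M⁺` for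
the character module `Hom_ℤ(M, ℚ/ℤ)`. Pairing characters with `Hom(P, M) ≅ M ⊗ P^*`, one finds for a
right module `M` that `Ext¹(Tr A, M⁺) = 0` if and only if every map `A → M` factors through a
finitely generated free module (`forall_mem_finiteRankMaps_iff`). For `A` running over the simple
modules the latter is neat-flatness. Moreover `M` is flat if and only if `M⁺` is absolutely pure,
and then `M⁺` is injective (`isFlatRight_of_isAbsolutelyPure`, `IsFlatRight.extOneVanishes`). Hence
flat modules are always neat-flat, and if absolute purity is detected by the modules `Tr S`, then
applying this to `M⁺` shows that neat-flat modules are flat.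

For the converse, suppose that neat-flat modules are flat, and let `Ext¹(Tr S, M) = 0` for all
simple `S` and a left module `M`. If `M⁺` is neat-flat, then it is flat, and so `M` is absolutely
pure (`isAbsolutelyPure_of_isFlatRight`). The delicate point is that `M⁺` is neat-flat. It is when
each `S^*` is finitely generated, in the sense that all functionals on `S` factor through one map
from `S` to a finitely generated projective module (`exists_factorization_of_extOneVanishes`). This
finiteness is not automatic, but follows from flatness of neat-flat modules
(`exists_projective_preenvelope`). Indeed, let `S` be a simple submodule of a finitely generated
projective module `F`. By Zorn's lemma there is a maximal locally artinian essential extension `L`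
of `S` in `F`; as simple modules are finitely presented, all maps from simple modules to `F ⧸ L`
lift to `F`, so `F ⧸ L` is neat-flat, hence flat (`exists_neat_hull`). Flatness gives an
endomorphism `θ` of `F` that has image in `L` and fixes `S`; the image of `θ` is artinian, and `θ`
is injective on it, hence bijective, so that the image is projective
(`exists_projective_essential_extension`). Now let `Y` be minimal among the finitely generated
projective submodules of this image that contain `S`. Applying the construction to the graph of a
functional `φ` in `Y × R` gives a finitely generated projective submodule of `Y` to which `φ`
extends. By minimality it is `Y`.
-/

noncomputable section

/-! ### Character modules -/

section Characters

/-- The character group `Hom_ℤ(M, ℚ/ℤ)` of a right `R`-module `M`, regarded as a left `R`-module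
through `(r • c) m = c (m · r)`. -/
def LeftCharacter (M : Type u) [AddCommGroup M] : Type u := M →+ AddCircle (1 : ℚ)

/-- The character group `Hom_ℤ(M, ℚ/ℤ)` of a left `R`-module `M`, regarded as a right `R`-module
through `(c · r) m = c (r • m)`. -/
def RightCharacter (M : Type u) [AddCommGroup M] : Type u := M →+ AddCircle (1 : ℚ)

instance (M : Type u) [AddCommGroup M] : AddCommGroup (LeftCharacter M) :=
  inferInstanceAs (AddCommGroup (M →+ AddCircle (1 : ℚ)))

instance (M : Type u) [AddCommGroup M] : AddCommGroup (RightCharacter M) :=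
  inferInstanceAs (AddCommGroup (M →+ AddCircle (1 : ℚ)))

instance (M : Type u) [AddCommGroup M] : FunLike (LeftCharacter M) M (AddCircle (1 : ℚ)) :=
  inferInstanceAs (FunLike (M →+ AddCircle (1 : ℚ)) M (AddCircle (1 : ℚ)))

instance (M : Type u) [AddCommGroup M] : FunLike (RightCharacter M) M (AddCircle (1 : ℚ)) :=
  inferInstanceAs (FunLike (M →+ AddCircle (1 : ℚ)) M (AddCircle (1 : ℚ)))

instance (M : Type u) [AddCommGroup M] :
    AddMonoidHomClass (LeftCharacter M) M (AddCircle (1 : ℚ)) :=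
  inferInstanceAs (AddMonoidHomClass (M →+ AddCircle (1 : ℚ)) M (AddCircle (1 : ℚ)))

instance (M : Type u) [AddCommGroup M] :
    AddMonoidHomClass (RightCharacter M) M (AddCircle (1 : ℚ)) :=
  inferInstanceAs (AddMonoidHomClass (M →+ AddCircle (1 : ℚ)) M (AddCircle (1 : ℚ)))

variable {R : Type u} [Ring R]

namespace LeftCharacter

variable {M : Type u} [AddCommGroup M]

@[ext] theorem ext {c d : LeftCharacter M} (h : ∀ m, c m = d m) : c = d := DFunLike.ext _ _ h

@[simp] theorem add_apply (c d : LeftCharacter M) (m : M) : (c + d) m = c m + d m := rfl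

@[simp] theorem zero_apply (m : M) : (0 : LeftCharacter M) m = 0 := rfl

instance [Module Rᵐᵒᵖ M] : Module R (LeftCharacter M) where
  smul r c := AddMonoidHom.comp c (DistribSMul.toAddMonoidHom M (MulOpposite.op r))
  one_smul c := ext fun m => congrArg c (one_smul Rᵐᵒᵖ m)
  mul_smul r s c := ext fun m => congrArg c (mul_smul (MulOpposite.op s) (MulOpposite.op r) m)
  smul_zero _ := rfl
  smul_add _ _ _ := rfl
  add_smul r s c := ext fun m =>
    (congrArg c (add_smul (MulOpposite.op r) (MulOpposite.op s) m)).trans (map_add c _ _)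
  zero_smul c := ext fun m => (congrArg c (zero_smul Rᵐᵒᵖ m)).trans (map_zero c)

@[simp] theorem smul_apply [Module Rᵐᵒᵖ M] (r : R) (c : LeftCharacter M) (m : M) :
    (r • c) m = c (MulOpposite.op r • m) := rfl

/-- Evaluation of characters at an element. -/
def evalHom (m : M) : LeftCharacter M →+ AddCircle (1 : ℚ) where
  toFun c := c m
  map_zero' := rfl
  map_add' _ _ := rfl

theorem sum_apply {ι : Type*} (s : Finset ι) (c : ι → LeftCharacter M) (m : M) :
    (∑ i ∈ s, c i) m = ∑ i ∈ s, c i m := map_sum (evalHom m) c s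

end LeftCharacter

namespace RightCharacter

variable {M : Type u} [AddCommGroup M]

@[ext] theorem ext {c d : RightCharacter M} (h : ∀ m, c m = d m) : c = d := DFunLike.ext _ _ h

instance [Module R M] : Module Rᵐᵒᵖ (RightCharacter M) where
  smul r c := AddMonoidHom.comp c (DistribSMul.toAddMonoidHom M r.unop)
  one_smul c := ext fun m => congrArg c (one_smul R m)
  mul_smul r s c := ext fun m => congrArg c (mul_smul s.unop r.unop m)
  smul_zero _ := rfl
  smul_add _ _ _ := rfl
  add_smul r s c := ext fun m =>
    (congrArg c (add_smul r.unop s.unop m)).trans (map_add c _ _)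
  zero_smul c := ext fun m => (congrArg c (zero_smul R m)).trans (map_zero c)

@[simp] theorem smul_apply [Module R M] (r : Rᵐᵒᵖ) (c : RightCharacter M) (m : M) :
    (r • c) m = c (r.unop • m) := rfl

/-- Evaluation of characters at an element. -/
def evalHom (m : M) : RightCharacter M →+ AddCircle (1 : ℚ) where
  toFun c := c m
  map_zero' := rfl
  map_add' _ _ := rfl

theorem sum_apply {ι : Type*} (s : Finset ι) (c : ι → RightCharacter M) (m : M) :
    (∑ i ∈ s, c i) m = ∑ i ∈ s, c i m := map_sum (evalHom m) c s

end RightCharacter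

/-- `ℚ/ℤ` is an injective abelian group. -/
theorem exists_character_comp_eq {A B : Type u} [AddCommGroup A] [AddCommGroup B] (f : A →+ B)
    (hf : Function.Injective f) (c : A →+ AddCircle (1 : ℚ)) :
    ∃ d : B →+ AddCircle (1 : ℚ), ∀ a, d (f a) = c a := by
  obtain ⟨d, hd⟩ := CharacterModule.dual_surjective_of_injective (R := ℤ) f.toIntLinearMap hf c
  exact ⟨d, fun a => DFunLike.congr_fun hd a⟩

/-- A character of `A` that kills the kernel of `f : A → B` comes from a character of `B`. -/
theorem exists_character_comp_eq_of_ker_le {A B : Type u} [AddCommGroup A] [AddCommGroup B]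
    (f : A →+ B) (c : A →+ AddCircle (1 : ℚ)) (h : ∀ a, f a = 0 → c a = 0) :
    ∃ d : B →+ AddCircle (1 : ℚ), ∀ a, d (f a) = c a := by
  obtain ⟨d, hd⟩ := exists_character_comp_eq (QuotientAddGroup.kerLift f)
    (QuotientAddGroup.kerLift_injective f)
    (QuotientAddGroup.lift f.ker c fun a ha => h a ha)
  exact ⟨d, fun a => hd (a : A ⧸ f.ker)⟩

/-- Characters separate an element from a subgroup that does not contain it. -/
theorem exists_character_ne_zero {A : Type u} [AddCommGroup A] (H : AddSubgroup A) {a : A}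
    (ha : a ∉ H) : ∃ c : A →+ AddCircle (1 : ℚ), (∀ x ∈ H, c x = 0) ∧ c a ≠ 0 := by
  have : (QuotientAddGroup.mk' H a) ≠ 0 := by
    simpa [QuotientAddGroup.eq_zero_iff] using ha
  obtain ⟨c, hc⟩ := CharacterModule.exists_character_apply_ne_zero_of_ne_zero this
  refine ⟨AddMonoidHom.comp c (QuotientAddGroup.mk' H), fun x hx => ?_, hc⟩
  have h0 : QuotientAddGroup.mk' H x = 0 := by
    simpa [QuotientAddGroup.eq_zero_iff] using hx
  change c (QuotientAddGroup.mk' H x) = 0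
  rw [h0]
  exact map_zero c

end Characters

/-! ### Duals of finitely generated projective modules -/

section Dual

variable {R : Type u} [Ring R]

theorem dual_map_smul {P : Type u} [AddCommGroup P] [Module Rᵐᵒᵖ P] (q : P →ₗ[Rᵐᵒᵖ] R)
    (r : Rᵐᵒᵖ) (x : P) : q (r • x) = q x * r.unop := by
  rw [map_smul]; rfl

/-- The map `P → M`, `p ↦ m · q(p)`, for a functional `q` on the right module `P` and an element
`m` of the right module `M`. -/
def smulFunctional {P M : Type u} [AddCommGroup P] [Module Rᵐᵒᵖ P] [AddCommGroup M]
    [Module Rᵐᵒᵖ M] (q : P →ₗ[Rᵐᵒᵖ] R) (m : M) : P →ₗ[Rᵐᵒᵖ] M where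
  toFun p := MulOpposite.op (q p) • m
  map_add' x y := by simp [add_smul]
  map_smul' r x := by
    rw [dual_map_smul, RingHom.id_apply, ← mul_smul]
    simp

@[simp] theorem smulFunctional_apply {P M : Type u} [AddCommGroup P] [Module Rᵐᵒᵖ P]
    [AddCommGroup M] [Module Rᵐᵒᵖ M] (q : P →ₗ[Rᵐᵒᵖ] R) (m : M) (p : P) :
    smulFunctional q m p = MulOpposite.op (q p) • m := rfl

/-- The map `P^* → M`, `q ↦ q(p) • m`, for an element `p` of the right module `P` and an element
`m` of the left module `M`. -/
def evalSMul {P M : Type u} [AddCommGroup P] [Module Rᵐᵒᵖ P] [AddCommGroup M]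
    [Module R M] (p : P) (m : M) : (P →ₗ[Rᵐᵒᵖ] R) →ₗ[R] M where
  toFun q := q p • m
  map_add' x y := by simp [add_smul]
  map_smul' r x := by simp [mul_smul]

@[simp] theorem evalSMul_apply {P M : Type u} [AddCommGroup P] [Module Rᵐᵒᵖ P] [AddCommGroup M]
    [Module R M] (p : P) (m : M) (q : P →ₗ[Rᵐᵒᵖ] R) : evalSMul p m q = q p • m := rfl

/-- The identification of `R`, as a right module over itself, with `Rᵐᵒᵖ`. -/
def unopLinear (R : Type u) [Ring R] : Rᵐᵒᵖ ≃ₗ[Rᵐᵒᵖ] R where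
  toFun := MulOpposite.unop
  invFun := MulOpposite.op
  map_add' _ _ := rfl
  map_smul' _ _ := rfl
  left_inv _ := rfl
  right_inv _ := rfl

/-- A dual basis of a right `R`-module `P`: elements `p_i` and functionals `q_i`, finitely many,
with `x = ∑ p_i · q_i(x)` for all `x`. -/
structure DualBasis (R : Type u) [Ring R] (P : Type u) [AddCommGroup P] [Module Rᵐᵒᵖ P] where
  n : ℕ
  elt : Fin n → P
  functional : Fin n → (P →ₗ[Rᵐᵒᵖ] R)
  sum_smul : ∀ x : P, ∑ i, MulOpposite.op (functional i x) • elt i = x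

theorem nonempty_dualBasis (R : Type u) [Ring R] (P : Type u) [AddCommGroup P] [Module Rᵐᵒᵖ P]
    [Module.Finite Rᵐᵒᵖ P] [Module.Projective Rᵐᵒᵖ P] : Nonempty (DualBasis R P) := by
  obtain ⟨n, f, hf⟩ := Module.Finite.exists_fin' Rᵐᵒᵖ P
  obtain ⟨g, hg⟩ := Module.projective_lifting_property f LinearMap.id hf
  refine ⟨n, fun i => f (Pi.single i 1),
    fun i => (unopLinear R).toLinearMap ∘ₗ LinearMap.proj i ∘ₗ g, fun x => ?_⟩
  have h : f (g x) = x := LinearMap.congr_fun hg x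
  conv_rhs => rw [← h, pi_eq_sum_univ' (g x), map_sum]
  refine Finset.sum_congr rfl fun i _ => ?_
  rw [← map_smul]
  congr 1

namespace DualBasis

variable {P : Type u} [AddCommGroup P] [Module Rᵐᵒᵖ P]

theorem sum_smul_functional (b : DualBasis R P) (q : P →ₗ[Rᵐᵒᵖ] R) : ∑ i, q (b.elt i) • b.functional i = q := by
  ext x
  conv_rhs => rw [← b.sum_smul x, map_sum]
  rw [LinearMap.sum_apply]
  refine Finset.sum_congr rfl fun i _ => ?_
  rw [dual_map_smul]
  rfl

theorem eq_sum_smulFunctional (b : DualBasis R P) {M : Type u} [AddCommGroup M]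
    [Module Rᵐᵒᵖ M] (u : P →ₗ[Rᵐᵒᵖ] M) :
    u = ∑ i, smulFunctional (b.functional i) (u (b.elt i)) := by
  ext x
  conv_lhs => rw [← b.sum_smul x, map_sum]
  simp [LinearMap.sum_apply]

theorem eq_sum_evalSMul (b : DualBasis R P) {M : Type u} [AddCommGroup M] [Module R M]
    (h : (P →ₗ[Rᵐᵒᵖ] R) →ₗ[R] M) : h = ∑ i, evalSMul (b.elt i) (h (b.functional i)) := by
  ext q
  conv_lhs => rw [← b.sum_smul_functional q, map_sum]
  simp [LinearMap.sum_apply]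

theorem finite_dual (b : DualBasis R P) : Module.Finite R (P →ₗ[Rᵐᵒᵖ] R) := by
  refine ⟨Submodule.fg_def.2 ⟨Set.range b.functional, Set.finite_range _, ?_⟩⟩
  rw [eq_top_iff]
  rintro q -
  rw [← b.sum_smul_functional q]
  refine Submodule.sum_mem _ fun i _ => Submodule.smul_mem _ _ (Submodule.subset_span ⟨i, rfl⟩)

theorem projective_dual (b : DualBasis R P) : Module.Projective R (P →ₗ[Rᵐᵒᵖ] R) := by
  refine Module.Projective.of_split (M := Fin b.n → R)
    (LinearMap.pi fun i => evalSMul (b.elt i) (1 : R))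
    (Fintype.linearCombination R b.functional) ?_
  ext1 q
  simpa [Fintype.linearCombination_apply] using b.sum_smul_functional q

end DualBasis

end Dual

/-! ### Vanishing of the first extension group -/

section Ext

open CategoryTheory CategoryTheory.Abelian

variable {R : Type u} [Ring R]

/-- If `0 → K → P → A → 0` is exact with `P` projective, then `Ext¹(A, M) = 0` means that every
map `K → M` extends to `P`. -/
theorem extOneVanishes_iff_of_exact {K P A : Type u} [AddCommGroup K] [Module R K]
    [AddCommGroup P] [Module R P] [AddCommGroup A] [Module R A] (M : Type u) [AddCommGroup M]
    [Module R M] [Module.Projective R P] (i : K →ₗ[R] P) (p : P →ₗ[R] A)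
    (hi : Function.Injective i) (hip : Function.Exact i p) (hp : Function.Surjective p) :
    ExtOneVanishes R A M ↔ ∀ h : K →ₗ[R] M, ∃ k : P →ₗ[R] M, k ∘ₗ i = h := by
  let C : ShortComplex (ModuleCat.{u} R) :=
    ShortComplex.mk (ModuleCat.ofHom i) (ModuleCat.ofHom p) (by
      ext x; exact hip.apply_apply_eq_zero x)
  have hC : C.ShortExact :=
    { exact := (ShortComplex.moduleCat_exact_iff C).2 fun x hx => (hip x).1 hx
      mono_f := (ModuleCat.mono_iff_injective _).2 hi
      epi_g := (ModuleCat.epi_iff_surjective _).2 hp }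
  have hP : Projective C.X₂ := (IsProjective.iff_projective P).1 inferInstance
  constructor
  · intro hA h
    have : Subsingleton (Ext C.X₃ (ModuleCat.of R M) 1) := hA
    obtain ⟨x, hx⟩ := Ext.contravariant_sequence_exact₁ hC (Y := ModuleCat.of R M)
      (Ext.mk₀ (ModuleCat.ofHom h)) (n₁ := 1) rfl (Subsingleton.elim _ _)
    obtain ⟨k, rfl⟩ := (Ext.mk₀_bijective _ _).2 x
    rw [Ext.mk₀_comp_mk₀] at hx
    have := (Ext.mk₀_bijective _ _).1 hx
    refine ⟨k.hom, ?_⟩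
    ext x
    exact congrArg (fun t => t.hom x) this
  · intro H
    refine subsingleton_of_forall_eq 0 fun x => ?_
    obtain ⟨y, hy⟩ := Ext.contravariant_sequence_exact₃ hC (Y := ModuleCat.of R M)
      x (Ext.eq_zero_of_projective _) (n₀ := 0) rfl
    obtain ⟨h, rfl⟩ := (Ext.mk₀_bijective _ _).2 y
    obtain ⟨k, hk⟩ := H h.hom
    have h1 : h = C.f ≫ ModuleCat.ofHom k := by
      ext x
      exact (LinearMap.congr_fun hk x).symm
    rw [← hy, h1, ← Ext.mk₀_comp_mk₀, hC.extClass_comp_assoc]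

/-- `Ext¹(Tr_γ A, M) = 0` if and only if every map `P₀^* → M` that vanishes on the kernel of
`f^* : P₀^* → P₁^*` factors through `f^*`. -/
theorem extOneVanishes_Tr_iff {A : Type u} [AddCommGroup A] [Module Rᵐᵒᵖ A]
    (γ : ProjPresentation R A) (M : Type u) [AddCommGroup M] [Module R M] :
    ExtOneVanishes R γ.Tr M ↔ ∀ h : (γ.P₀ →ₗ[Rᵐᵒᵖ] R) →ₗ[R] M,
      (∀ q : γ.P₀ →ₗ[Rᵐᵒᵖ] R, q ∘ₗ γ.f = 0 → h q = 0) →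
        ∃ k : (γ.P₁ →ₗ[Rᵐᵒᵖ] R) →ₗ[R] M, ∀ q, k (q ∘ₗ γ.f) = h q := by
  have := γ.finite₁
  have := γ.projective₁
  obtain ⟨b⟩ := nonempty_dualBasis R γ.P₁
  have := b.projective_dual
  rw [extOneVanishes_iff_of_exact (K := LinearMap.range γ.dualMap) (P := γ.P₁ →ₗ[Rᵐᵒᵖ] R)
    (A := γ.Tr) M (LinearMap.range γ.dualMap).subtype
    (LinearMap.range γ.dualMap).mkQ (Submodule.injective_subtype _)
    (LinearMap.exact_subtype_mkQ _) (Submodule.mkQ_surjective _)]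
  constructor
  · intro H h hh
    let e := (LinearMap.ker γ.dualMap).liftQ h (fun q hq => hh q hq) ∘ₗ
      (γ.dualMap.quotKerEquivRange.symm).toLinearMap
    obtain ⟨k, hk⟩ := H e
    refine ⟨k, fun q => ?_⟩
    have h1 := LinearMap.congr_fun hk ⟨γ.dualMap q, q, rfl⟩
    refine h1.trans ?_
    have h2 : γ.dualMap.quotKerEquivRange.symm ⟨γ.dualMap q, q, rfl⟩ =
        Submodule.Quotient.mk q := by
      rw [LinearEquiv.symm_apply_eq]; rfl
    simp only [e, LinearMap.comp_apply, LinearEquiv.coe_coe, h2]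
    rfl
  · intro H h
    obtain ⟨k, hk⟩ := H (h ∘ₗ γ.dualMap.rangeRestrict) (fun q hq => by
      have : γ.dualMap.rangeRestrict q = 0 := Subtype.ext hq
      simp [this])
    refine ⟨k, ?_⟩
    ext ⟨_, q, rfl⟩
    exact hk q

theorem finitePresentation_Tr {A : Type u} [AddCommGroup A] [Module Rᵐᵒᵖ A]
    (γ : ProjPresentation R A) : Module.FinitePresentation R γ.Tr := by
  have := γ.finite₁
  have := γ.projective₁
  have := γ.finite₀
  have := γ.projective₀
  obtain ⟨b⟩ := nonempty_dualBasis R γ.P₁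
  obtain ⟨b'⟩ := nonempty_dualBasis R γ.P₀
  have := b.projective_dual
  have := b.finite_dual
  have := b'.finite_dual
  have := Module.finitePresentation_of_projective R (γ.P₁ →ₗ[Rᵐᵒᵖ] R)
  refine Module.finitePresentation_of_surjective (LinearMap.range γ.dualMap).mkQ
    (Submodule.mkQ_surjective _) ?_
  rw [Submodule.ker_mkQ]
  exact (Module.Finite.iff_fg).1 inferInstance

end Ext

/-! ### Maps of finite rank and neat-flat modules -/

section FiniteRank

variable {R : Type u} [Ring R]

/-- The group of maps `A → M` of right modules of the form `∑ m_j · φ_j`, with finitely many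
`φ_j : A → R` and `m_j ∈ M`: the maps that factor through a finitely generated free module. -/
def finiteRankMaps (R : Type u) [Ring R] (A M : Type u) [AddCommGroup A] [Module Rᵐᵒᵖ A]
    [AddCommGroup M] [Module Rᵐᵒᵖ M] : AddSubgroup (A →ₗ[Rᵐᵒᵖ] M) :=
  AddSubgroup.closure {v | ∃ (φ : A →ₗ[Rᵐᵒᵖ] R) (m : M), v = smulFunctional φ m}

variable {A M : Type u} [AddCommGroup A] [Module Rᵐᵒᵖ A] [AddCommGroup M] [Module Rᵐᵒᵖ M]

theorem smulFunctional_mem_finiteRankMaps (φ : A →ₗ[Rᵐᵒᵖ] R) (m : M) :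
    smulFunctional φ m ∈ finiteRankMaps R A M :=
  AddSubgroup.subset_closure ⟨φ, m, rfl⟩

theorem exists_lift_of_mem_finiteRankMaps {N : Type u} [AddCommGroup N] [Module Rᵐᵒᵖ N]
    (f : N →ₗ[Rᵐᵒᵖ] M) (hf : Function.Surjective f) {v : A →ₗ[Rᵐᵒᵖ] M}
    (hv : v ∈ finiteRankMaps R A M) : ∃ w : A →ₗ[Rᵐᵒᵖ] N, f ∘ₗ w = v := by
  induction hv using AddSubgroup.closure_induction with
  | mem v hv =>
    obtain ⟨φ, m, rfl⟩ := hv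
    obtain ⟨n, rfl⟩ := hf m
    exact ⟨smulFunctional φ n, by ext x; simp⟩
  | zero => exact ⟨0, by simp⟩
  | add v v' _ _ h h' =>
    obtain ⟨w, rfl⟩ := h
    obtain ⟨w', rfl⟩ := h'
    exact ⟨w + w', LinearMap.comp_add _ _ _⟩
  | neg v _ h =>
    obtain ⟨w, rfl⟩ := h
    exact ⟨-w, LinearMap.comp_neg _ _⟩

/-- Precomposition with a map of right modules, as a homomorphism of groups. -/
def precompHom (M : Type u) [AddCommGroup M] [Module Rᵐᵒᵖ M] {P Q : Type u} [AddCommGroup P]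
    [Module Rᵐᵒᵖ P] [AddCommGroup Q] [Module Rᵐᵒᵖ Q] (f : P →ₗ[Rᵐᵒᵖ] Q) :
    (Q →ₗ[Rᵐᵒᵖ] M) →+ (P →ₗ[Rᵐᵒᵖ] M) where
  toFun u := u ∘ₗ f
  map_zero' := LinearMap.zero_comp f
  map_add' _ _ := LinearMap.add_comp _ _ _

@[simp] theorem precompHom_apply {P Q : Type u} [AddCommGroup P]
    [Module Rᵐᵒᵖ P] [AddCommGroup Q] [Module Rᵐᵒᵖ Q] (f : P →ₗ[Rᵐᵒᵖ] Q) (u : Q →ₗ[Rᵐᵒᵖ] M) :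
    precompHom M f u = u ∘ₗ f := rfl

theorem comp_mem_finiteRankMaps {P : Type u} [AddCommGroup P] [Module Rᵐᵒᵖ P]
    [Module.Finite Rᵐᵒᵖ P] [Module.Projective Rᵐᵒᵖ P] (w : P →ₗ[Rᵐᵒᵖ] M) (u : A →ₗ[Rᵐᵒᵖ] P) :
    w ∘ₗ u ∈ finiteRankMaps R A M := by
  obtain ⟨b⟩ := nonempty_dualBasis R P
  rw [b.eq_sum_smulFunctional w, ← precompHom_apply, map_sum]
  exact AddSubgroup.sum_mem _ fun i _ =>
    smulFunctional_mem_finiteRankMaps (b.functional i ∘ₗ u) (w (b.elt i))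

/-- If every epimorphism onto `M` lifts maps from the finitely generated module `A`, then every map
`A → M` factors through a finitely generated free module. -/
theorem mem_finiteRankMaps_of_lifts [Module.Finite Rᵐᵒᵖ A] (v : A →ₗ[Rᵐᵒᵖ] M)
    (h : ∀ (N : Type u) [AddCommGroup N] [Module Rᵐᵒᵖ N] (f : N →ₗ[Rᵐᵒᵖ] M),
      Function.Surjective f → ∃ w : A →ₗ[Rᵐᵒᵖ] N, f ∘ₗ w = v) : v ∈ finiteRankMaps R A M := by
  classical
  obtain ⟨w, rfl⟩ := h (M →₀ Rᵐᵒᵖ) (Finsupp.linearCombination Rᵐᵒᵖ id)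
    (Finsupp.linearCombination_id_surjective Rᵐᵒᵖ M)
  obtain ⟨s, hs⟩ := Module.Finite.fg_top (R := Rᵐᵒᵖ) (M := A)
  -- The images of finitely many generators of `A` involve finitely many basis elements.
  let t : Finset M := s.biUnion fun a => (w a).support
  have ht : ∀ a : A, w a ∈ Finsupp.supported Rᵐᵒᵖ Rᵐᵒᵖ (t : Set M) := by
    intro a
    have ha : a ∈ Submodule.span Rᵐᵒᵖ (s : Set A) := hs ▸ Submodule.mem_top
    have hle : Submodule.span Rᵐᵒᵖ (s : Set A) ≤
        (Finsupp.supported Rᵐᵒᵖ Rᵐᵒᵖ (t : Set M)).comap w := by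
      refine Submodule.span_le.2 fun b hb => ?_
      change ((w b).support : Set M) ⊆ t
      exact_mod_cast Finset.subset_biUnion_of_mem (fun a => (w a).support) hb
    exact hle ha
  have : Finsupp.linearCombination Rᵐᵒᵖ id ∘ₗ w =
      ∑ m ∈ t, smulFunctional ((unopLinear R).toLinearMap ∘ₗ Finsupp.lapply m ∘ₗ w) m := by
    ext a
    rw [LinearMap.comp_apply, Finsupp.linearCombination_apply,
      Finsupp.sum_of_support_subset (s := t) _ (by exact_mod_cast ht a) _ (by simp)]
    simp [LinearMap.sum_apply, unopLinear]
  rw [this]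
  exact AddSubgroup.sum_mem _ fun m _ => smulFunctional_mem_finiteRankMaps _ m

theorem isNeatFlatRight_iff : IsNeatFlatRight R M ↔
    ∀ (S : Type u) [AddCommGroup S] [Module Rᵐᵒᵖ S] [IsSimpleModule Rᵐᵒᵖ S]
      (v : S →ₗ[Rᵐᵒᵖ] M), v ∈ finiteRankMaps R S M := by
  constructor
  · intro h S _ _ _ v
    exact mem_finiteRankMaps_of_lifts v fun N _ _ f hf => h N f hf S v
  · intro h N _ _ f hf S _ _ _ v
    exact exists_lift_of_mem_finiteRankMaps f hf (h S v)

/-- The character of `Hom(P, M)` determined by a map `h : P^* → M⁺`; it sends `m · q` to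
`h q m`. -/
def homCharacter {P : Type u} [AddCommGroup P] [Module Rᵐᵒᵖ P] (b : DualBasis R P)
    (h : (P →ₗ[Rᵐᵒᵖ] R) →ₗ[R] LeftCharacter M) :
    (P →ₗ[Rᵐᵒᵖ] M) →+ AddCircle (1 : ℚ) where
  toFun u := ∑ i, h (b.functional i) (u (b.elt i))
  map_zero' := by simp
  map_add' u u' := by simp [Finset.sum_add_distrib]

theorem homCharacter_smulFunctional {P : Type u} [AddCommGroup P] [Module Rᵐᵒᵖ P]
    (b : DualBasis R P) (h : (P →ₗ[Rᵐᵒᵖ] R) →ₗ[R] LeftCharacter M) (q : P →ₗ[Rᵐᵒᵖ] R) (m : M) :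
    homCharacter b h (smulFunctional q m) = h q m := by
  conv_rhs => rw [← b.sum_smul_functional q, map_sum, LeftCharacter.sum_apply]
  simp [homCharacter]

/-- The map `P^* → M⁺` determined by a character of `Hom(P, M)`. -/
def characterCurry {P : Type u} [AddCommGroup P] [Module Rᵐᵒᵖ P]
    (χ : (P →ₗ[Rᵐᵒᵖ] M) →+ AddCircle (1 : ℚ)) :
    (P →ₗ[Rᵐᵒᵖ] R) →ₗ[R] LeftCharacter M where
  toFun q := AddMonoidHom.mk' (fun m => χ (smulFunctional q m)) fun m m' => by
    rw [← map_add]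
    congr 1
    ext x
    simp
  map_add' q q' := by
    ext m
    change χ _ = χ _ + χ _
    rw [← map_add]
    congr 1
    ext x
    simp [add_smul]
  map_smul' r q := by
    ext m
    change χ _ = χ _
    congr 1
    ext x
    simp [mul_smul]

theorem characterCurry_apply {P : Type u} [AddCommGroup P] [Module Rᵐᵒᵖ P]
    (χ : (P →ₗ[Rᵐᵒᵖ] M) →+ AddCircle (1 : ℚ)) (q : P →ₗ[Rᵐᵒᵖ] R) (m : M) :
    characterCurry χ q m = χ (smulFunctional q m) := rfl

theorem exists_comp_eq_of_comp_eq_zero (γ : ProjPresentation R A) {N : Type u} [AddCommGroup N]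
    [Module Rᵐᵒᵖ N] (u : γ.P₀ →ₗ[Rᵐᵒᵖ] N) (hu : u ∘ₗ γ.f = 0) :
    ∃ v : A →ₗ[Rᵐᵒᵖ] N, v ∘ₗ γ.g = u := by
  have hk : LinearMap.ker γ.g ≤ LinearMap.ker u := by
    intro x hx
    obtain ⟨y, rfl⟩ := (γ.exact x).1 hx
    exact LinearMap.congr_fun hu y
  refine ⟨(LinearMap.ker γ.g).liftQ u hk ∘ₗ
    (γ.g.quotKerEquivOfSurjective γ.surjective).symm.toLinearMap, ?_⟩
  ext x
  have : (γ.g.quotKerEquivOfSurjective γ.surjective).symm (γ.g x) = Submodule.Quotient.mk x := by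
    rw [LinearEquiv.symm_apply_eq]; rfl
  simp only [LinearMap.comp_apply, LinearEquiv.coe_coe, this]
  rfl

theorem ProjPresentation.g_comp_f (γ : ProjPresentation R A) : γ.g ∘ₗ γ.f = 0 :=
  γ.exact.linearMap_comp_eq_zero

/-- Every map `A → M` factors through a finitely generated free module if and only if
`Ext¹(Tr A, M⁺) = 0`. Both say that the characters of `Hom(P₀, M)` that kill all maps of finite
rank `A → M` are exactly those induced from `Hom(P₁, M)`, that is, those that kill all maps
`A → M`. -/
theorem forall_mem_finiteRankMaps_iff (γ : ProjPresentation R A) :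
    (∀ v : A →ₗ[Rᵐᵒᵖ] M, v ∈ finiteRankMaps R A M) ↔
      ExtOneVanishes R γ.Tr (LeftCharacter M) := by
  have := γ.finite₁
  have := γ.projective₁
  have := γ.finite₀
  have := γ.projective₀
  obtain ⟨b₁⟩ := nonempty_dualBasis R γ.P₁
  obtain ⟨b₀⟩ := nonempty_dualBasis R γ.P₀
  rw [extOneVanishes_Tr_iff]
  constructor
  · intro H h hh
    have hfr : ∀ v ∈ finiteRankMaps R A M, homCharacter b₀ h (v ∘ₗ γ.g) = 0 := by
      intro v hv
      have : finiteRankMaps R A M ≤ ((homCharacter b₀ h).comp (precompHom M γ.g)).ker := by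
        refine (AddSubgroup.closure_le _).2 ?_
        rintro _ ⟨φ, m, rfl⟩
        change homCharacter b₀ h (smulFunctional (φ ∘ₗ γ.g) m) = 0
        rw [homCharacter_smulFunctional, hh (φ ∘ₗ γ.g)
          (by rw [LinearMap.comp_assoc, γ.g_comp_f, LinearMap.comp_zero])]
        rfl
      exact this hv
    obtain ⟨χ, hχ⟩ := exists_character_comp_eq_of_ker_le (precompHom M γ.f) (homCharacter b₀ h)
      (fun u hu => by
        obtain ⟨v, rfl⟩ := exists_comp_eq_of_comp_eq_zero γ u hu
        exact hfr v (H v))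
    refine ⟨characterCurry χ, fun q => ?_⟩
    ext m
    exact (hχ (smulFunctional q m)).trans (homCharacter_smulFunctional b₀ h q m)
  · intro H v
    by_contra hv
    have hv' : v ∘ₗ γ.g ∉ (finiteRankMaps R A M).map (precompHom M γ.g) := by
      rintro ⟨w, hw, hwv⟩
      have : w = v := by
        ext x
        obtain ⟨y, rfl⟩ := γ.surjective x
        exact LinearMap.congr_fun hwv y
      exact hv (this ▸ hw)
    obtain ⟨χ, hχ, hne⟩ := exists_character_ne_zero _ hv'
    obtain ⟨k, hk⟩ := H (characterCurry χ) (fun q hq => by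
      obtain ⟨φ, rfl⟩ := exists_comp_eq_of_comp_eq_zero γ q hq
      ext m
      exact hχ _ ⟨smulFunctional φ m, smulFunctional_mem_finiteRankMaps φ m, rfl⟩)
    have key : ∀ u : γ.P₀ →ₗ[Rᵐᵒᵖ] M, χ u = homCharacter b₁ k (u ∘ₗ γ.f) := by
      intro u
      rw [b₀.eq_sum_smulFunctional u, ← precompHom_apply, map_sum, map_sum, map_sum]
      refine Finset.sum_congr rfl fun i _ => ?_
      rw [← characterCurry_apply, ← hk]
      exact (homCharacter_smulFunctional b₁ k (b₀.functional i ∘ₗ γ.f) _).symm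
    refine hne ?_
    rw [key, LinearMap.comp_assoc, γ.g_comp_f, LinearMap.comp_zero, map_zero]

end FiniteRank

/-! ### Flat right modules and their character modules -/

section Flat

variable {R : Type u} [Ring R] {M : Type u} [AddCommGroup M] [Module Rᵐᵒᵖ M]

/-- The element `m ⊗ n` of `M ⊗_R N`. -/
def balancedTmul (R : Type u) [Ring R] {M N : Type u} [AddCommGroup M] [Module Rᵐᵒᵖ M]
    [AddCommGroup N] [Module R N] (m : M) (n : N) : BalancedTensor R M N :=
  QuotientAddGroup.mk (m ⊗ₜ[ℤ] n)

section

variable {N N' : Type u} [AddCommGroup N] [Module R N] [AddCommGroup N'] [Module R N']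

theorem balancedTmul_add_left (m m' : M) (n : N) :
    balancedTmul R (m + m') n = balancedTmul R m n + balancedTmul R m' n :=
  congrArg (QuotientAddGroup.mk' (balancingSubgroup R M N)) (TensorProduct.add_tmul m m' n)

theorem balancedTmul_add_right (m : M) (n n' : N) :
    balancedTmul R m (n + n') = balancedTmul R m n + balancedTmul R m n' :=
  congrArg (QuotientAddGroup.mk' (balancingSubgroup R M N)) (TensorProduct.tmul_add m n n')

theorem op_smul_balancedTmul (m : M) (r : R) (n : N) :
    balancedTmul R (MulOpposite.op r • m) n = balancedTmul R m (r • n) := by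
  refine QuotientAddGroup.eq_iff_sub_mem.2 (AddSubgroup.subset_closure ⟨m, r, n, rfl⟩)

theorem balancedTensor_induction {p : BalancedTensor R M N → Prop} (zero : p 0)
    (tmul : ∀ m n, p (balancedTmul R m n)) (add : ∀ s t, p s → p t → p (s + t))
    (t : BalancedTensor R M N) : p t := by
  obtain ⟨t, rfl⟩ := QuotientAddGroup.mk_surjective t
  induction t using TensorProduct.induction_on with
  | zero => exact zero
  | tmul m n => exact tmul m n
  | add s t hs ht => exact add _ _ hs ht

/-- The character of `M ⊗_R N` determined by a map `N → M⁺`. -/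
def tensorCharacter (h : N →ₗ[R] LeftCharacter M) :
    BalancedTensor R M N →+ AddCircle (1 : ℚ) :=
  QuotientAddGroup.lift _ (TensorProduct.liftAddHom
    (AddMonoidHom.flip (AddMonoidHom.mk' (fun n => (h n : M →+ AddCircle (1 : ℚ)))
      fun n n' => map_add h n n'))
    (fun z m n => by simp)) ((AddSubgroup.closure_le _).2 (by
      rintro _ ⟨m, r, n, rfl⟩
      refine (map_sub _ _ _).trans (sub_eq_zero.2 ?_)
      change h n (MulOpposite.op r • m) = h (r • n) m
      exact (DFunLike.congr_fun (h.map_smul r n) m).symm))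

/-- The map `N → M⁺` determined by a character of `M ⊗_R N`. -/
def tensorCurry (χ : BalancedTensor R M N →+ AddCircle (1 : ℚ)) : N →ₗ[R] LeftCharacter M where
  toFun n := AddMonoidHom.mk' (fun m => χ (balancedTmul R m n)) fun m m' => by
    rw [balancedTmul_add_left, map_add]
  map_add' n n' := by
    ext m
    change χ _ = χ _ + χ _
    rw [balancedTmul_add_right, map_add]
  map_smul' r n := by
    ext m
    change χ _ = χ _
    rw [← op_smul_balancedTmul]
    rfl

/-- `M ⊗_R f` is injective if and only if maps to `M⁺` extend along `f`. -/
theorem balancedTensorMap_injective_iff (f : N →ₗ[R] N') :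
    Function.Injective (balancedTensorMap R M f) ↔
      ∀ h : N →ₗ[R] LeftCharacter M, ∃ k : N' →ₗ[R] LeftCharacter M, k ∘ₗ f = h := by
  constructor
  · intro hf h
    obtain ⟨χ, hχ⟩ := exists_character_comp_eq (balancedTensorMap R M f) hf (tensorCharacter h)
    refine ⟨tensorCurry χ, ?_⟩
    ext n m
    exact hχ (balancedTmul R m n)
  · intro H
    refine (injective_iff_map_eq_zero _).2 fun t ht => ?_
    refine CharacterModule.eq_zero_of_character_apply fun χ => ?_
    obtain ⟨k, hk⟩ := H (tensorCurry χ)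
    have key : ∀ s : BalancedTensor R M N,
        tensorCharacter k (balancedTensorMap R M f s) = χ s := by
      intro s
      induction s using balancedTensor_induction with
      | zero => rw [map_zero, map_zero]; exact (map_zero χ).symm
      | tmul m n => exact DFunLike.congr_fun (LinearMap.congr_fun hk n) m
      | add s t hs ht => rw [map_add, map_add, hs, ht]; exact (map_add χ _ _).symm
    rw [← key, ht, map_zero]

theorem balancedTensorMap_comp {N'' : Type u} [AddCommGroup N''] [Module R N'']
    (g : N' →ₗ[R] N'') (f : N →ₗ[R] N') (t : BalancedTensor R M N) :
    balancedTensorMap R M g (balancedTensorMap R M f t) = balancedTensorMap R M (g ∘ₗ f) t := by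
  induction t using balancedTensor_induction with
  | zero => simp
  | tmul m n => rfl
  | add s t hs ht => simp only [map_add, hs, ht]

theorem exists_fg_balancedTensorMap_eq (t : BalancedTensor R M N) :
    ∃ K : Submodule R N, K.FG ∧ ∃ s : BalancedTensor R M K,
      balancedTensorMap R M K.subtype s = t := by
  induction t using balancedTensor_induction with
  | zero => exact ⟨⊥, Submodule.fg_bot, 0, map_zero _⟩
  | tmul m n =>
    exact ⟨Submodule.span R {n}, Submodule.fg_span_singleton n,
      balancedTmul R m ⟨n, Submodule.mem_span_singleton_self n⟩, rfl⟩
  | add s t hs ht =>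
    obtain ⟨K, hK, s, rfl⟩ := hs
    obtain ⟨L, hL, t, rfl⟩ := ht
    refine ⟨K ⊔ L, hK.sup hL,
      balancedTensorMap R M (Submodule.inclusion le_sup_left) s +
        balancedTensorMap R M (Submodule.inclusion le_sup_right) t, ?_⟩
    rw [map_add, balancedTensorMap_comp, balancedTensorMap_comp]
    rfl

end

theorem IsAbsolutelyPure.exists_extension {N : Type u} [AddCommGroup N] [Module R N]
    (hN : IsAbsolutelyPure R N) {K P : Type u} [AddCommGroup K] [Module R K] [AddCommGroup P]
    [Module R P] [Module.Finite R K] [Module.Finite R P] [Module.Projective R P]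
    (i : K →ₗ[R] P) (hi : Function.Injective i) (h : K →ₗ[R] N) :
    ∃ k : P →ₗ[R] N, k ∘ₗ i = h := by
  have := Module.finitePresentation_of_projective R P
  have : Module.FinitePresentation R (P ⧸ LinearMap.range i) :=
    Module.finitePresentation_of_surjective (LinearMap.range i).mkQ (Submodule.mkQ_surjective _)
      (by rw [Submodule.ker_mkQ]; exact (Module.Finite.iff_fg).1 inferInstance)
  exact (extOneVanishes_iff_of_exact N i (LinearMap.range i).mkQ hi
    (LinearMap.exact_map_mkQ_range i) (Submodule.mkQ_surjective _)).1
    (hN (P ⧸ LinearMap.range i)) h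

/-- A right module is flat as soon as its character module is absolutely pure: by Baer's criterion
only left ideals matter, and tensors over a left ideal live over a finitely generated one. -/
theorem isFlatRight_of_isAbsolutelyPure (hM : IsAbsolutelyPure R (LeftCharacter M)) :
    IsFlatRight R M := by
  have hideal : ∀ I : Submodule R R, Function.Injective (balancedTensorMap R M I.subtype) := by
    intro I
    refine (injective_iff_map_eq_zero _).2 fun t ht => ?_
    obtain ⟨K, hK, s, rfl⟩ := exists_fg_balancedTensorMap_eq t
    have : Module.Finite R K := Module.Finite.iff_fg.2 hK
    have hinj := (balancedTensorMap_injective_iff (M := M) (I.subtype ∘ₗ K.subtype)).2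
      (hM.exists_extension (I.subtype ∘ₗ K.subtype)
        (I.injective_subtype.comp K.injective_subtype))
    rw [balancedTensorMap_comp] at ht
    rw [(injective_iff_map_eq_zero _).1 hinj s ht, map_zero]
  have hbaer : Module.Baer R (LeftCharacter M) := by
    intro I g
    obtain ⟨k, hk⟩ := (balancedTensorMap_injective_iff (M := M) I.subtype).1 (hideal I) g
    exact ⟨k, fun x hx => LinearMap.congr_fun hk ⟨x, hx⟩⟩
  intro N N' _ _ _ _ f hf
  refine (balancedTensorMap_injective_iff f).2 fun h => ?_
  obtain ⟨k, hk⟩ := hbaer.injective.out f hf h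
  exact ⟨k, LinearMap.ext hk⟩

/-- A flat right module has no `Ext¹` into its character module, since the latter is injective. -/
theorem IsFlatRight.extOneVanishes (hM : IsFlatRight R M) (A : Type u) [AddCommGroup A]
    [Module R A] : ExtOneVanishes R A (LeftCharacter M) := by
  let p := Finsupp.linearCombination R (id : A → A)
  refine (extOneVanishes_iff_of_exact (K := LinearMap.ker p) (P := A →₀ R) (A := A) _
    (LinearMap.ker p).subtype p (Submodule.injective_subtype _) (LinearMap.exact_subtype_ker_map p)
    (Finsupp.linearCombination_id_surjective R A)).2 ?_
  exact (balancedTensorMap_injective_iff _).1 (hM _ _ _ (Submodule.injective_subtype _))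

/-- A map from a finitely presented right module to a flat one factors through a finitely generated
free module. -/
theorem IsFlatRight.mem_finiteRankMaps (hM : IsFlatRight R M) {A : Type u} [AddCommGroup A]
    [Module Rᵐᵒᵖ A] (γ : ProjPresentation R A) (v : A →ₗ[Rᵐᵒᵖ] M) : v ∈ finiteRankMaps R A M :=
  (forall_mem_finiteRankMaps_iff γ).2 (hM.extOneVanishes _) v

end Flat

/-! ### Absolutely pure modules with flat character module -/

section AbsolutelyPure

variable {R : Type u} [Ring R] {M : Type u} [AddCommGroup M] [Module R M]

/-- Evaluation, as a map from a left module to its bidual. -/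
def toBidual (R : Type u) [Ring R] (M : Type u) [AddCommGroup M] [Module R M] :
    M →ₗ[R] LeftCharacter (RightCharacter M) where
  toFun m := RightCharacter.evalHom m
  map_add' m m' := by
    ext c
    exact map_add c m m'
  map_smul' _ _ := rfl

/-- A map from a finitely generated submodule of a finite free module that extends with values in
the bidual `M⁺⁺` extends with values in `M`. -/
theorem exists_extension_of_toBidual {n : ℕ} (K : Submodule R (Fin n → R)) (hK : K.FG)
    (h : K →ₗ[R] M) (k : (Fin n → R) →ₗ[R] LeftCharacter (RightCharacter M))
    (hk : k ∘ₗ K.subtype = toBidual R M ∘ₗ h) :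
    ∃ k' : (Fin n → R) →ₗ[R] M, k' ∘ₗ K.subtype = h := by
  have : Module.Finite R K := Module.Finite.iff_fg.2 hK
  obtain ⟨m, e, he⟩ := Module.Finite.exists_fin' R K
  let y : Fin m → K := fun j => e (Pi.single j 1)
  let restr : ((Fin n → R) →ₗ[R] M) →+ (K →ₗ[R] M) :=
    { toFun := fun u => u ∘ₗ K.subtype
      map_zero' := LinearMap.zero_comp _
      map_add' := fun _ _ => LinearMap.add_comp _ _ _ }
  let ev : (K →ₗ[R] M) →+ (Fin m → M) :=
    { toFun := fun u j => u (y j)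
      map_zero' := rfl
      map_add' := fun _ _ => rfl }
  have hev : Function.Injective ev := by
    intro u u' huu
    have : u ∘ₗ e = u' ∘ₗ e := LinearMap.pi_ext' fun j => LinearMap.ext_ring (congrFun huu j)
    ext x
    obtain ⟨z, rfl⟩ := he x
    exact LinearMap.congr_fun this z
  by_contra hne
  have hmem : h ∉ restr.range := fun ⟨k', hk'⟩ => hne ⟨k', hk'⟩
  obtain ⟨ξ, hξ, hξh⟩ := exists_character_ne_zero _ hmem
  obtain ⟨ξ', hξ'⟩ := exists_character_comp_eq ev hev ξ
  -- The character `ξ` has the form `u ↦ ∑ c_j (u y_j)`.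
  let c : Fin m → RightCharacter M := fun j => ξ'.comp (AddMonoidHom.single (fun _ => M) j)
  have hc : ∀ u : K →ₗ[R] M, ξ u = ∑ j, c j (u (y j)) := by
    intro u
    rw [← hξ', ← Finset.univ_sum_single (ev u), map_sum]
    rfl
  have hc0 : ∀ i, ∑ j, MulOpposite.op ((y j : Fin n → R) i) • c j = 0 := by
    intro i
    ext x
    rw [RightCharacter.sum_apply]
    have := hξ _ ⟨(LinearMap.proj i : (Fin n → R) →ₗ[R] R).smulRight x, rfl⟩
    rw [hc] at this
    exact this
  refine hξh ?_
  calc ξ h = ∑ j, k (y j) (c j) := by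
        rw [hc]
        refine Finset.sum_congr rfl fun j _ => ?_
        exact (DFunLike.congr_fun (LinearMap.congr_fun hk (y j)) (c j)).symm
    _ = ∑ j, ∑ i, k (Pi.single i 1) (MulOpposite.op ((y j : Fin n → R) i) • c j) := by
        refine Finset.sum_congr rfl fun j _ => ?_
        rw [LinearMap.pi_apply_eq_sum_univ k, LeftCharacter.sum_apply]
        refine Finset.sum_congr rfl fun i _ => ?_
        rw [LeftCharacter.smul_apply]
        congr 3
        ext l
        simp [Pi.single_apply, eq_comm]
    _ = 0 := by
        rw [Finset.sum_comm]
        refine Finset.sum_eq_zero fun i _ => ?_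
        rw [← map_sum, hc0, map_zero]

theorem isAbsolutelyPure_of_isFlatRight (hM : IsFlatRight R (RightCharacter M)) :
    IsAbsolutelyPure R M := by
  intro A _ _ _
  obtain ⟨n, f, hf⟩ := Module.Finite.exists_fin' R A
  refine (extOneVanishes_iff_of_exact M (LinearMap.ker f).subtype f
    (Submodule.injective_subtype _) (LinearMap.exact_subtype_ker_map f) hf).2 fun h => ?_
  obtain ⟨k, hk⟩ := (balancedTensorMap_injective_iff (LinearMap.ker f).subtype).1
    (hM _ _ _ (Submodule.injective_subtype _)) (toBidual R M ∘ₗ h)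
  exact exists_extension_of_toBidual _ (Module.FinitePresentation.fg_ker f hf) h k hk

end AbsolutelyPure

/-! ### Maps to character modules -/

section Preenvelope

variable {R : Type u} [Ring R]

/-- The character of `Hom_R(P^*, M)` determined by a map `u : P → M⁺` of right modules. -/
def dualHomCharacter {P M : Type u} [AddCommGroup P] [Module Rᵐᵒᵖ P] [AddCommGroup M] [Module R M]
    (b : DualBasis R P) (u : P →ₗ[Rᵐᵒᵖ] RightCharacter M) :
    ((P →ₗ[Rᵐᵒᵖ] R) →ₗ[R] M) →+ AddCircle (1 : ℚ) where
  toFun h := ∑ i, u (b.elt i) (h (b.functional i))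
  map_zero' := by simp
  map_add' h h' := by simp [Finset.sum_add_distrib]

theorem dualHomCharacter_evalSMul {P M : Type u} [AddCommGroup P] [Module Rᵐᵒᵖ P]
    [AddCommGroup M] [Module R M] (b : DualBasis R P) (u : P →ₗ[Rᵐᵒᵖ] RightCharacter M)
    (p : P) (m : M) : dualHomCharacter b u (evalSMul p m) = u p m := by
  conv_rhs => rw [← b.sum_smul p, map_sum, RightCharacter.sum_apply]
  simp [dualHomCharacter]

/-- The map `P → M⁺` determined by a character of `Hom_R(P^*, M)`. -/
def dualCharacterCurry {P M : Type u} [AddCommGroup P] [Module Rᵐᵒᵖ P] [AddCommGroup M]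
    [Module R M] (χ : ((P →ₗ[Rᵐᵒᵖ] R) →ₗ[R] M) →+ AddCircle (1 : ℚ)) :
    P →ₗ[Rᵐᵒᵖ] RightCharacter M where
  toFun p := AddMonoidHom.mk' (fun m => χ (evalSMul p m)) fun m m' => by
    rw [← map_add]
    congr 1
    ext q
    simp
  map_add' p p' := by
    ext m
    change χ _ = χ _ + χ _
    rw [← map_add]
    congr 1
    ext q
    simp [add_smul]
  map_smul' r p := by
    ext m
    change χ _ = χ _
    congr 1
    ext q
    simp [mul_smul]

/-- Let `ι : A → P` be a map to a finitely generated projective module through which all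
functionals on `A` factor. If `Ext¹(Tr A, M) = 0`, then all maps `A → M⁺` factor through `ι`. -/
theorem exists_factorization_of_extOneVanishes {A P M : Type u} [AddCommGroup A] [Module Rᵐᵒᵖ A]
    [AddCommGroup P] [Module Rᵐᵒᵖ P] [AddCommGroup M] [Module R M]
    (γ : ProjPresentation R A) (hM : ExtOneVanishes R γ.Tr M) (ι : A →ₗ[Rᵐᵒᵖ] P)
    (hι : ∀ φ : A →ₗ[Rᵐᵒᵖ] R, ∃ ψ : P →ₗ[Rᵐᵒᵖ] R, ψ ∘ₗ ι = φ)
    (v : A →ₗ[Rᵐᵒᵖ] RightCharacter M) : ∃ w : P →ₗ[Rᵐᵒᵖ] RightCharacter M, w ∘ₗ ι = v := by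
  have := γ.finite₁
  have := γ.projective₁
  have := γ.finite₀
  have := γ.projective₀
  obtain ⟨b₁⟩ := nonempty_dualBasis R γ.P₁
  obtain ⟨b₀⟩ := nonempty_dualBasis R γ.P₀
  let Φ : ((γ.P₀ →ₗ[Rᵐᵒᵖ] R) →ₗ[R] M) →+ ((P →ₗ[Rᵐᵒᵖ] R) →ₗ[R] M) :=
    { toFun := fun h => h ∘ₗ LinearMap.lcomp R R (ι ∘ₗ γ.g)
      map_zero' := LinearMap.zero_comp _
      map_add' := fun _ _ => LinearMap.add_comp _ _ _ }
  have hker : ∀ h, Φ h = 0 → dualHomCharacter b₀ (v ∘ₗ γ.g) h = 0 := by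
    intro h hh
    obtain ⟨k, hk⟩ := (extOneVanishes_Tr_iff γ M).1 hM h (fun q hq => by
      obtain ⟨φ, rfl⟩ := exists_comp_eq_of_comp_eq_zero γ q hq
      obtain ⟨ψ, rfl⟩ := hι φ
      exact LinearMap.congr_fun hh ψ)
    have : h = ∑ j, evalSMul (γ.f (b₁.elt j)) (k (b₁.functional j)) := by
      ext q
      rw [← hk, b₁.eq_sum_evalSMul k]
      conv_rhs => rw [← b₁.eq_sum_evalSMul k]
      simp [LinearMap.sum_apply]
    rw [this, map_sum]
    refine Finset.sum_eq_zero fun j _ => ?_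
    rw [dualHomCharacter_evalSMul, LinearMap.comp_apply, γ.exact.apply_apply_eq_zero, map_zero]
    rfl
  obtain ⟨χ, hχ⟩ := exists_character_comp_eq_of_ker_le Φ _ hker
  refine ⟨dualCharacterCurry χ, ?_⟩
  ext x m
  obtain ⟨p, rfl⟩ := γ.surjective x
  exact (hχ (evalSMul p m)).trans (dualHomCharacter_evalSMul b₀ _ p m)

end Preenvelope

/-! ### Projective extensions of simple modules -/

section SimpleSubmodules

variable {T : Type u} [Ring T]

/-- If all simple modules are finitely presented, then a simple submodule `S` of `F` is contained in
a submodule `L` that is locally artinian, an essential extension of `S`, and such that every map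
from a simple module to `F ⧸ L` lifts to `F`. -/
theorem exists_neat_hull
    (hfp : ∀ (S : Type u) [AddCommGroup S] [Module T S] [IsSimpleModule T S],
      Module.FinitePresentation T S)
    {F : Type u} [AddCommGroup F] [Module T F] (S : Submodule T F) [IsSimpleModule T S] :
    ∃ L : Submodule T F, S ≤ L ∧ (∀ Y ≤ L, Y.FG → IsArtinian T Y) ∧
      (∀ X ≤ L, X ≠ ⊥ → S ≤ X) ∧
      ∀ (S' : Type u) [AddCommGroup S'] [Module T S'] [IsSimpleModule T S']
        (v : S' →ₗ[T] F ⧸ L), ∃ w : S' →ₗ[T] F, L.mkQ ∘ₗ w = v := by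
  let G : Set (Submodule T F) :=
    {L | (∀ Y ≤ L, Y.FG → IsArtinian T Y) ∧ ∀ X ≤ L, X ≠ ⊥ → S ≤ X}
  have hS : S ∈ G := by
    refine ⟨fun Y hY _ => isArtinian_of_le hY, fun X hX hX0 => ?_⟩
    exact ((isSimpleModule_iff_isAtom.1 ‹IsSimpleModule T S›).le_iff.1 hX |>.resolve_left hX0).ge
  have hchain : ∀ c ⊆ G, IsChain (· ≤ ·) c → ∀ y ∈ c, ∃ ub ∈ G, ∀ z ∈ c, z ≤ ub := by
    intro c hcG hc y hy
    have hle : ∀ Y : Submodule T F, Y.FG → Y ≤ sSup c → ∃ L ∈ c, Y ≤ L := fun Y hY hYc =>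
      (CompleteLattice.isCompactElement_iff_le_of_directed_sSup_le _ Y).1
        ((Submodule.fg_iff_compact Y).1 hY) c ⟨y, hy⟩ hc.directedOn hYc
    refine ⟨sSup c, ⟨fun Y hY hfg => ?_, fun X hX hX0 => ?_⟩, fun z hz => le_sSup hz⟩
    · obtain ⟨L, hL, hYL⟩ := hle Y hfg hY
      exact (hcG hL).1 Y hYL hfg
    · obtain ⟨x, hx, hx0⟩ := Submodule.exists_mem_ne_zero_of_ne_bot hX0
      have hxX : Submodule.span T {x} ≤ X := (Submodule.span_singleton_le_iff_mem x X).2 hx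
      obtain ⟨L, hL, hxL⟩ := hle _ (Submodule.fg_span_singleton x) (hxX.trans hX)
      exact ((hcG hL).2 _ hxL (by simpa using hx0)).trans hxX
  obtain ⟨L, hSL, hL⟩ := zorn_le_nonempty₀ G hchain S hS
  refine ⟨L, hSL, hL.prop.1, hL.prop.2, fun S' _ _ _ v => ?_⟩
  obtain hv | rfl := LinearMap.injective_or_eq_zero v
  swap
  · exact ⟨0, by simp⟩
  have := hfp S'
  -- Any map into `F ⧸ L` with image in that of `v` comes from a map into `S'`.
  let L' : Submodule T F := (LinearMap.range v).comap L.mkQ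
  let ρ : L' →ₗ[T] S' := (LinearEquiv.ofInjective v hv).symm.toLinearMap ∘ₗ
    (L.mkQ ∘ₗ L'.subtype).codRestrict (LinearMap.range v) (fun x => x.2)
  have hρ : ∀ x : L', v (ρ x) = L.mkQ x := fun x =>
    congrArg Subtype.val ((LinearEquiv.ofInjective v hv).apply_symm_apply _)
  have hρ0 : ∀ x : L', ρ x = 0 ↔ (x : F) ∈ L := by
    intro x
    rw [← Submodule.Quotient.mk_eq_zero L, ← hv.eq_iff, map_zero, hρ]
    rfl
  have hLL' : L ≤ L' := fun x hx => by
    exact ⟨0, (map_zero v).trans ((Submodule.Quotient.mk_eq_zero L).2 hx).symm⟩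
  have hart : ∀ Y ≤ L', Y.FG → IsArtinian T Y := by
    intro Y hY hfg
    have : Module.Finite T Y := Module.Finite.iff_fg.2 hfg
    let σ : Y →ₗ[T] S' := ρ ∘ₗ Submodule.inclusion hY
    have hker : (LinearMap.ker σ).FG := by
      obtain hσ | hσ := LinearMap.surjective_or_eq_zero σ
      · exact Module.FinitePresentation.fg_ker σ hσ
      · rw [hσ, LinearMap.ker_zero]
        exact Module.Finite.fg_top
    have hmap : IsArtinian T ((LinearMap.ker σ).map Y.subtype) := by
      refine hL.prop.1 _ ?_ (hker.map _)
      rintro _ ⟨x, hx, rfl⟩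
      exact (hρ0 _).1 hx
    have : IsArtinian T (LinearMap.ker σ) :=
      isArtinian_of_linearEquiv
        (Submodule.equivMapOfInjective Y.subtype Y.injective_subtype (LinearMap.ker σ)).symm
    exact isArtinian_of_range_eq_ker (LinearMap.ker σ).subtype σ (Submodule.range_subtype _)
  -- By maximality of `L`, the larger submodule `L'` is no longer essential over `S`.
  have hnot : ¬ ∀ X ≤ L', X ≠ ⊥ → S ≤ X := by
    intro hess
    have hle : L' ≤ L := hL.le_of_ge ⟨hart, hess⟩ hLL'
    have := IsSimpleModule.nontrivial T S'
    obtain ⟨s, hs⟩ := exists_ne (0 : S')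
    obtain ⟨x, hx⟩ := L.mkQ_surjective (v s)
    have hxL : x ∈ L := hle ⟨s, hx.symm⟩
    refine hs (hv ?_)
    rw [← hx, map_zero]
    exact (Submodule.Quotient.mk_eq_zero L).2 hxL
  push Not at hnot
  obtain ⟨X, hX, hX0, hSX⟩ := hnot
  have hXL : X ⊓ L = ⊥ := by
    by_contra h0
    exact hSX ((hL.prop.2 _ inf_le_right h0).trans inf_le_left)
  let τ : X →ₗ[T] S' := ρ ∘ₗ Submodule.inclusion hX
  have hτi : Function.Injective τ := by
    refine (injective_iff_map_eq_zero _).2 fun x hx => ?_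
    have : (x : F) ∈ X ⊓ L := ⟨x.2, (hρ0 _).1 hx⟩
    rw [hXL] at this
    exact Subtype.ext ((Submodule.mem_bot T).1 this)
  have hτs : Function.Surjective τ := by
    refine (LinearMap.surjective_or_eq_zero τ).resolve_right fun h0 => hX0 ?_
    refine (Submodule.eq_bot_iff X).2 fun x hx => ?_
    have : (⟨x, hx⟩ : X) = 0 := hτi (by rw [h0]; rfl)
    exact congrArg Subtype.val this
  refine ⟨X.subtype ∘ₗ (LinearEquiv.ofBijective τ ⟨hτi, hτs⟩).symm.toLinearMap, ?_⟩
  ext s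
  obtain ⟨x, rfl⟩ := hτs s
  have : (LinearEquiv.ofBijective τ ⟨hτi, hτs⟩).symm (τ x) = x := by
    rw [LinearEquiv.symm_apply_eq]; rfl
  simp only [LinearMap.comp_apply, LinearEquiv.coe_coe, this]
  exact (hρ (Submodule.inclusion hX x)).symm

variable {R : Type u} [Ring R]

/-- Suppose that simple right modules are finitely presented and neat-flat right modules are flat.
Then a simple submodule `S` of a finitely generated projective module is contained in a
finitely generated, artinian, projective submodule in which it is essential. -/
theorem exists_projective_essential_extension
    (hfp : ∀ (S : Type u) [AddCommGroup S] [Module Rᵐᵒᵖ S] [IsSimpleModule Rᵐᵒᵖ S],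
      Module.FinitePresentation Rᵐᵒᵖ S)
    (hflat : ∀ (M : Type u) [AddCommGroup M] [Module Rᵐᵒᵖ M],
      IsNeatFlatRight R M → IsFlatRight R M)
    {F : Type u} [AddCommGroup F] [Module Rᵐᵒᵖ F] [Module.Finite Rᵐᵒᵖ F]
    [Module.Projective Rᵐᵒᵖ F] (S : Submodule Rᵐᵒᵖ F) [IsSimpleModule Rᵐᵒᵖ S] :
    ∃ L : Submodule Rᵐᵒᵖ F, S ≤ L ∧ Module.Finite Rᵐᵒᵖ L ∧ Module.Projective Rᵐᵒᵖ L ∧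
      IsArtinian Rᵐᵒᵖ L ∧ ∀ X ≤ L, X ≠ ⊥ → S ≤ X := by
  obtain ⟨L, hSL, hart, hess, hlift⟩ := exists_neat_hull hfp S
  have hL : IsFlatRight R (F ⧸ L) := by
    refine hflat _ fun N _ _ f hf S' _ _ _ v => ?_
    obtain ⟨w, rfl⟩ := hlift S' v
    obtain ⟨a, ha⟩ := Module.projective_lifting_property f L.mkQ hf
    exact ⟨a ∘ₗ w, by simp only [← LinearMap.comp_assoc, ha]⟩
  obtain ⟨n, e, he⟩ := Module.Finite.exists_fin' Rᵐᵒᵖ S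
  let γ : ProjPresentation R (F ⧸ S) :=
    { P₁ := Fin n → Rᵐᵒᵖ, P₀ := F,
      finite₁ := inferInstance, finite₀ := inferInstance,
      projective₁ := inferInstance, projective₀ := inferInstance,
      f := S.subtype ∘ₗ e, g := S.mkQ,
      exact := by
        rw [LinearMap.exact_iff, Submodule.ker_mkQ, LinearMap.range_comp,
          LinearMap.range_eq_top.2 he, Submodule.map_top, Submodule.range_subtype]
      surjective := S.mkQ_surjective }
  -- As `F ⧸ L` is flat, the projection `F ⧸ S → F ⧸ L` lifts to `F`; so some endomorphism `θ` of
  -- `F` with image in `L` is the identity on `S`.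
  obtain ⟨σ, hσ⟩ := exists_lift_of_mem_finiteRankMaps L.mkQ L.mkQ_surjective
    (hL.mem_finiteRankMaps γ (Submodule.factor hSL))
  let θ : F →ₗ[Rᵐᵒᵖ] F := LinearMap.id - σ ∘ₗ S.mkQ
  have hθS : ∀ x ∈ S, θ x = x := by
    intro x hx
    have : S.mkQ x = 0 := (Submodule.Quotient.mk_eq_zero S).2 hx
    simp only [θ, LinearMap.sub_apply, LinearMap.id_apply, LinearMap.comp_apply, this, map_zero,
      sub_zero]
  have hθL : LinearMap.range θ ≤ L := by
    rintro _ ⟨x, rfl⟩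
    have h1 : L.mkQ (σ (S.mkQ x)) = L.mkQ x := LinearMap.congr_fun hσ (S.mkQ x)
    rw [← Submodule.ker_mkQ L, LinearMap.mem_ker]
    simp only [θ, LinearMap.sub_apply, LinearMap.id_apply, LinearMap.comp_apply, map_sub, h1,
      sub_self]
  have hSθ : S ≤ LinearMap.range θ := fun x hx => ⟨x, hθS x hx⟩
  have hfin : Module.Finite Rᵐᵒᵖ (LinearMap.range θ) := inferInstance
  have := hart _ hθL (Module.Finite.iff_fg.1 hfin)
  refine ⟨LinearMap.range θ, hSθ, hfin, ?_, this, fun X hX => hess X (hX.trans hθL)⟩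
  -- The restriction of `θ` to its artinian image is injective, as its kernel does not contain `S`.
  let τ : LinearMap.range θ →ₗ[Rᵐᵒᵖ] LinearMap.range θ :=
    θ.rangeRestrict ∘ₗ (LinearMap.range θ).subtype
  have hτ : Function.Injective τ := by
    rw [← LinearMap.ker_eq_bot]
    by_contra h0
    have hle := hess ((LinearMap.ker τ).map (LinearMap.range θ).subtype)
      ((Submodule.map_subtype_le _ _).trans hθL)
      fun h => h0 (Submodule.map_injective_of_injective (Submodule.injective_subtype _)
        (h.trans (Submodule.map_bot _).symm))
    have := IsSimpleModule.nontrivial Rᵐᵒᵖ S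
    obtain ⟨s, hs⟩ := exists_ne (0 : S)
    obtain ⟨y, hy, hys⟩ := hle s.2
    have hθs : θ s = 0 := by
      rw [← hys]
      exact congrArg Subtype.val (LinearMap.mem_ker.1 hy)
    exact hs (Subtype.ext ((hθS s s.2).symm.trans hθs))
  have hτb := IsArtinian.bijective_of_injective_endomorphism τ hτ
  refine Module.Projective.of_split
    ((LinearMap.range θ).subtype ∘ₗ (LinearEquiv.ofBijective τ hτb).symm.toLinearMap)
    θ.rangeRestrict ?_
  exact LinearMap.ext fun x => (LinearEquiv.ofBijective τ hτb).apply_symm_apply x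

theorem exists_projective_essential_extension_range
    (hfp : ∀ (S : Type u) [AddCommGroup S] [Module Rᵐᵒᵖ S] [IsSimpleModule Rᵐᵒᵖ S],
      Module.FinitePresentation Rᵐᵒᵖ S)
    (hflat : ∀ (M : Type u) [AddCommGroup M] [Module Rᵐᵒᵖ M],
      IsNeatFlatRight R M → IsFlatRight R M)
    {S F : Type u} [AddCommGroup S] [Module Rᵐᵒᵖ S] [IsSimpleModule Rᵐᵒᵖ S]
    [AddCommGroup F] [Module Rᵐᵒᵖ F] [Module.Finite Rᵐᵒᵖ F] [Module.Projective Rᵐᵒᵖ F]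
    (δ : S →ₗ[Rᵐᵒᵖ] F) (hδ : Function.Injective δ) :
    ∃ L : Submodule Rᵐᵒᵖ F, (∀ s, δ s ∈ L) ∧ Module.Finite Rᵐᵒᵖ L ∧ Module.Projective Rᵐᵒᵖ L ∧
      IsArtinian Rᵐᵒᵖ L ∧ ∀ X ≤ L, X ≠ ⊥ → ∀ s, δ s ∈ X := by
  have := IsSimpleModule.congr (LinearEquiv.ofInjective δ hδ).symm
  obtain ⟨L, h, hf, hp, ha, hess⟩ :=
    exists_projective_essential_extension hfp hflat (LinearMap.range δ)
  exact ⟨L, fun s => h ⟨s, rfl⟩, hf, hp, ha, fun X hX hX0 s => hess X hX hX0 ⟨s, rfl⟩⟩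

/-- Under the same hypotheses, a functional on a simple submodule `S` of a finitely generated
projective module `P` extends to a finitely generated projective submodule of `P` containing `S`:
the graph of the functional is a copy of `S` in `P × R`, and a projective module in which that copy
is essential projects injectively to `P`. -/
theorem exists_projective_extension_of_functional
    (hfp : ∀ (S : Type u) [AddCommGroup S] [Module Rᵐᵒᵖ S] [IsSimpleModule Rᵐᵒᵖ S],
      Module.FinitePresentation Rᵐᵒᵖ S)
    (hflat : ∀ (M : Type u) [AddCommGroup M] [Module Rᵐᵒᵖ M],
      IsNeatFlatRight R M → IsFlatRight R M)
    {S P : Type u} [AddCommGroup S] [Module Rᵐᵒᵖ S] [IsSimpleModule Rᵐᵒᵖ S]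
    [AddCommGroup P] [Module Rᵐᵒᵖ P] [Module.Finite Rᵐᵒᵖ P] [Module.Projective Rᵐᵒᵖ P]
    (ι : S →ₗ[Rᵐᵒᵖ] P) (hι : Function.Injective ι) (φ : S →ₗ[Rᵐᵒᵖ] R) :
    ∃ X : Submodule Rᵐᵒᵖ P, Module.Finite Rᵐᵒᵖ X ∧ Module.Projective Rᵐᵒᵖ X ∧
      ∃ (hX : ∀ s, ι s ∈ X) (β : X →ₗ[Rᵐᵒᵖ] R), ∀ s, β ⟨ι s, hX s⟩ = φ s := by
  have hRf : Module.Finite Rᵐᵒᵖ R := Module.Finite.equiv (unopLinear R)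
  have hRp : Module.Projective Rᵐᵒᵖ R := Module.Projective.of_equiv (unopLinear R)
  have hδ : Function.Injective (ι.prod φ) := fun s t hst => hι (congrArg Prod.fst hst)
  obtain ⟨Z, hδZ, hZf, hZp, -, hess⟩ :=
    exists_projective_essential_extension_range hfp hflat (ι.prod φ) hδ
  let π : Z →ₗ[Rᵐᵒᵖ] P := LinearMap.fst Rᵐᵒᵖ P R ∘ₗ Z.subtype
  have hπ : Function.Injective π := by
    rw [← LinearMap.ker_eq_bot]
    by_contra hk
    have hle := hess ((LinearMap.ker π).map Z.subtype) (Submodule.map_subtype_le _ _)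
      fun h => hk (Submodule.map_injective_of_injective (Submodule.injective_subtype _)
        (h.trans (Submodule.map_bot _).symm))
    have := IsSimpleModule.nontrivial Rᵐᵒᵖ S
    obtain ⟨s, hs⟩ := exists_ne (0 : S)
    obtain ⟨z, hz, hzs⟩ := hle s
    refine hs (hι ?_)
    rw [map_zero]
    exact (congrArg Prod.fst hzs).symm.trans (LinearMap.mem_ker.1 hz)
  let e := LinearEquiv.ofInjective π hπ
  refine ⟨LinearMap.range π, Module.Finite.equiv e, Module.Projective.of_equiv e,
    fun s => ⟨⟨_, hδZ s⟩, rfl⟩, LinearMap.snd Rᵐᵒᵖ P R ∘ₗ Z.subtype ∘ₗ e.symm.toLinearMap,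
    fun s => ?_⟩
  have : e.symm ⟨ι s, ⟨⟨_, hδZ s⟩, rfl⟩⟩ = ⟨_, hδZ s⟩ := by
    rw [LinearEquiv.symm_apply_eq]; rfl
  simp only [LinearMap.comp_apply, LinearEquiv.coe_coe, this]
  rfl

/-- Under the same hypotheses, let `S` be a simple submodule of a finitely generated, artinian,
projective module. All functionals on `S` extend to a minimal finitely generated projective
submodule containing `S`. -/
theorem exists_projective_preenvelope_of_injective
    (hfp : ∀ (S : Type u) [AddCommGroup S] [Module Rᵐᵒᵖ S] [IsSimpleModule Rᵐᵒᵖ S],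
      Module.FinitePresentation Rᵐᵒᵖ S)
    (hflat : ∀ (M : Type u) [AddCommGroup M] [Module Rᵐᵒᵖ M],
      IsNeatFlatRight R M → IsFlatRight R M)
    {S P : Type u} [AddCommGroup S] [Module Rᵐᵒᵖ S] [IsSimpleModule Rᵐᵒᵖ S]
    [AddCommGroup P] [Module Rᵐᵒᵖ P] [Module.Finite Rᵐᵒᵖ P] [Module.Projective Rᵐᵒᵖ P]
    [IsArtinian Rᵐᵒᵖ P] (ι₀ : S →ₗ[Rᵐᵒᵖ] P) (hι₀ : Function.Injective ι₀) :
    ∃ Y : Submodule Rᵐᵒᵖ P, Module.Finite Rᵐᵒᵖ Y ∧ Module.Projective Rᵐᵒᵖ Y ∧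
      ∃ ι : S →ₗ[Rᵐᵒᵖ] Y, ∀ φ : S →ₗ[Rᵐᵒᵖ] R, ∃ ψ : Y →ₗ[Rᵐᵒᵖ] R, ψ ∘ₗ ι = φ := by
  obtain ⟨Y, ⟨hSY, hYf, hYp⟩, hmin⟩ := IsArtinian.set_has_minimal
    {Y : Submodule Rᵐᵒᵖ P | LinearMap.range ι₀ ≤ Y ∧ Module.Finite Rᵐᵒᵖ Y ∧
      Module.Projective Rᵐᵒᵖ Y}
    ⟨⊤, le_top, Module.Finite.equiv Submodule.topEquiv.symm,
      Module.Projective.of_equiv Submodule.topEquiv.symm⟩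
  let ι : S →ₗ[Rᵐᵒᵖ] Y := ι₀.codRestrict Y fun s => hSY ⟨s, rfl⟩
  have hι : Function.Injective ι := fun s t hst => hι₀ (congrArg Subtype.val hst)
  refine ⟨Y, hYf, hYp, ι, fun φ => ?_⟩
  obtain ⟨X, hXf, hXp, hX, β, hβ⟩ :=
    exists_projective_extension_of_functional hfp hflat ι hι φ
  have hXtop : X.map Y.subtype = Y := by
    refine (Submodule.map_subtype_le Y X).eq_or_lt.resolve_right (hmin _ ⟨?_, ?_, ?_⟩)
    · rintro _ ⟨s, rfl⟩
      exact ⟨ι s, hX s, rfl⟩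
    · exact Module.Finite.equiv (Submodule.equivMapOfInjective _ Y.injective_subtype X)
    · exact Module.Projective.of_equiv (Submodule.equivMapOfInjective _ Y.injective_subtype X)
  have hmem : ∀ y : Y, y ∈ X := by
    intro y
    have hy : (y : P) ∈ X.map Y.subtype := hXtop.symm ▸ y.2
    obtain ⟨x, hx, hxy⟩ := hy
    exact (Subtype.ext hxy : x = y) ▸ hx
  exact ⟨β ∘ₗ LinearMap.id.codRestrict X hmem, LinearMap.ext hβ⟩

/-- Under the same hypotheses, every simple right module `S` has a map `ι` to a finitely generated
projective module through which all functionals on `S` factor; equivalently, `S^*` is finitely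
generated. -/
theorem exists_projective_preenvelope
    (hfp : ∀ (S : Type u) [AddCommGroup S] [Module Rᵐᵒᵖ S] [IsSimpleModule Rᵐᵒᵖ S],
      Module.FinitePresentation Rᵐᵒᵖ S)
    (hflat : ∀ (M : Type u) [AddCommGroup M] [Module Rᵐᵒᵖ M],
      IsNeatFlatRight R M → IsFlatRight R M)
    (S : Type u) [AddCommGroup S] [Module Rᵐᵒᵖ S] [IsSimpleModule Rᵐᵒᵖ S] :
    ∃ (P : Type u) (_ : AddCommGroup P) (_ : Module Rᵐᵒᵖ P) (ι : S →ₗ[Rᵐᵒᵖ] P),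
      Module.Finite Rᵐᵒᵖ P ∧ Module.Projective Rᵐᵒᵖ P ∧
        ∀ φ : S →ₗ[Rᵐᵒᵖ] R, ∃ ψ : P →ₗ[Rᵐᵒᵖ] R, ψ ∘ₗ ι = φ := by
  have hRf : Module.Finite Rᵐᵒᵖ R := Module.Finite.equiv (unopLinear R)
  have hRp : Module.Projective Rᵐᵒᵖ R := Module.Projective.of_equiv (unopLinear R)
  by_cases h0 : ∀ φ : S →ₗ[Rᵐᵒᵖ] R, φ = 0
  · exact ⟨PUnit, inferInstance, inferInstance, 0, inferInstance, inferInstance,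
      fun φ => ⟨0, by rw [h0 φ, LinearMap.zero_comp]⟩⟩
  push Not at h0
  obtain ⟨φ₀, hφ₀⟩ := h0
  have hφi := LinearMap.injective_of_ne_zero hφ₀
  obtain ⟨L, hSL, hLf, hLp, hLa, -⟩ :=
    exists_projective_essential_extension_range hfp hflat φ₀ hφi
  obtain ⟨Y, hYf, hYp, ι, hι⟩ := exists_projective_preenvelope_of_injective hfp hflat
    (φ₀.codRestrict L hSL) (fun s t hst => hφi (congrArg Subtype.val hst))
  exact ⟨Y, inferInstance, inferInstance, ι, hYf, hYp, hι⟩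

end SimpleSubmodules

end

/-- `γ` is an arbitrary choice, for each simple right module `S`, of the presentation from which
`Tr(S)` is formed; one exists because every such `S` is finitely presented. -/
theorem proposition4p15 (R : Type u) [Ring R]
    (hfp : ∀ (S : Type u) [AddCommGroup S] [Module Rᵐᵒᵖ S] [IsSimpleModule Rᵐᵒᵖ S],
      Module.FinitePresentation Rᵐᵒᵖ S)
    (γ : ∀ (S : Type u) [AddCommGroup S] [Module Rᵐᵒᵖ S] [IsSimpleModule Rᵐᵒᵖ S],
      ProjPresentation R S) :
    (∀ (M : Type u) [AddCommGroup M] [Module R M],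
      IsAbsolutelyPure R M ↔
        ∀ (S : Type u) [AddCommGroup S] [Module Rᵐᵒᵖ S] [IsSimpleModule Rᵐᵒᵖ S],
          ExtOneVanishes R (γ S).Tr M) ↔
    (∀ (M : Type u) [AddCommGroup M] [Module Rᵐᵒᵖ M],
      IsFlatRight R M ↔ IsNeatFlatRight R M) := by
  constructor
  · intro h M _ _
    refine ⟨fun hM => isNeatFlatRight_iff.2 fun S _ _ _ v => hM.mem_finiteRankMaps (γ S) v,
      fun hM => isFlatRight_of_isAbsolutelyPure ((h _).2 fun S _ _ _ => ?_)⟩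
    exact (forall_mem_finiteRankMaps_iff (γ S)).1 (isNeatFlatRight_iff.1 hM S)
  · intro h M _ _
    refine ⟨fun hM S _ _ _ => ?_, fun hM => isAbsolutelyPure_of_isFlatRight ((h _).2 ?_)⟩
    · have := finitePresentation_Tr (γ S)
      exact hM (γ S).Tr
    · refine isNeatFlatRight_iff.2 fun S _ _ _ v => ?_
      obtain ⟨P, _, _, ι, _, _, hι⟩ :=
        exists_projective_preenvelope hfp (fun M _ _ => (h M).2) S
      obtain ⟨w, rfl⟩ := exists_factorization_of_extOneVanishes (γ S) (hM S) ι hι v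
      exact comp_mem_finiteRankMaps w ι
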